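/- Let $\sigma>0$ and $k>0$ be known. One observes $\hat\theta_e\sim N(\theta_e,\sigma^2)$, where the unknown parameter $\theta=(\theta_e,\theta_t)$ lies in $\Theta=\{(\theta_e,\theta_t)\in\mathbb{R}^2:\theta_t\in[\theta_e-k,\theta_e+k]\}$. Let $\mathcal{D}$ be the set of all (measurable) rules $\hat\delta:\mathbb{R}\to[0,1]$, and let the mean square regret of $\hat\delta$ at $\theta$ be \[R_{sq}(\hat\delta,\theta)=\theta_t^2\,\mathbb{E}_{\hat\theta_e\sim N(\theta_e,\sigma^2)}\left[\left(\mathbf{1}\{\theta_t\ge 0\}-\hat\delta(\hat\theta_e)\right)^2\right].\] For $a\ge 0$ put $\rho(a)=\mathbb{E}_{Y\sim N(a,1)}\left[\left(\frac{1}{\exp(2aY)+1}\right)^2\right]$. For $a_e\ge 0$ and $a_t\in[a_e-k,a_e+k]$ the one-dimensional subproblem $(a_e,a_t)$ is the problem with parameter space $\Theta_{a_e,a_t}=\{s(a_e,a_t):s\in[-1,1]\}\subseteq\Theta$. A subproblem is called hardest if its minimax value $\inf_{\hat\delta\in\mathcal{D}}\sup_{\theta\in\Theta_{a_e,a_t}}R_{sq}(\hat\delta,\theta)$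 is the largest among all these subproblems. Then the function $\tau\mapsto\tau^2\rho(\tau)$ has a maximizer $\tau^*$ over $[0,\infty)$, and for each such $\tau^*$ the function $\tilde a\mapsto(\tilde a+k/\sigma)^2\rho(\tilde a)$ has a maximizer $a^*$ over $[0,\tau^*]$. For each such $a^*$ the logistic rule \[\hat\delta^*_{\mathrm H}(\hat\theta_e)=\frac{\exp(2a^*\hat\theta_e/\sigma)}{\exp(2a^*\hat\theta_e/\sigma)+1}\] is minimax optimal in terms of mean square regret on the whole two-dimensional parameter space: \[\sup_{\theta\in\Theta}R_{sq}(\hat\delta^*_{\mathrm H},\theta)=\min_{\hat\delta\in\mathcal{D}}\sup_{\theta\in\Theta}R_{sq}(\hat\delta,\theta).\] Moreover, the subproblem $(a^*\sigma,a^*\sigma+k)$ is a hardest one-dimensional subproblem; with $\Theta_{\mathrm H}=\Theta_{a^*\sigma,a^*\sigma+k}$ one has $\sup_{\theta\in\Theta}R_{sq}(\hat\delta^*_{\mathrm H},\theta)=\sup_{\theta\in\Theta_{\mathrm H}}R_{sq}(\hat\delta^*_{\mathrm H},\theta)$, and this worst case over $\Theta$ is attained at a point of $\Theta_{\mathrm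 H}$. -/

import Mathlib

open MeasureTheory ProbabilityTheory Set

noncomputable section

namespace MeanSquareRegret

/-- The identified set `I(θ_e) = [θ_e - k, θ_e + k]` of the target effect `θ_t`. -/
def identifiedSet (k θe : ℝ) : Set ℝ := Icc (θe - k) (θe + k)

/-- The parameter space `Θ`; a parameter is a pair `θ = (θ_e, θ_t)`. -/
def paramSpace (k : ℝ) : Set (ℝ × ℝ) := {θ | θ.2 ∈ identifiedSet k θ.1}

/-- The statistical treatment rules: measurable functions of the estimate, with values in the
unit interval. -/
def rules : Set (ℝ → ℝ) := {δ | Measurable δ ∧ ∀ x, δ x ∈ Icc (0 : ℝ) 1}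

/-- The infeasible optimal policy `1{θ_t ≥ 0}`. -/
def oracle (θt : ℝ) : ℝ := if 0 ≤ θt then 1 else 0

/-- The mean square regret `θ_t² E[(1{θ_t ≥ 0} - δ(X))²]`, where `X ~ N(θ_e, σ²)`. -/
def risk (σ : ℝ) (δ : ℝ → ℝ) (θ : ℝ × ℝ) : ℝ :=
  θ.2 ^ 2 * ∫ x, (oracle θ.2 - δ x) ^ 2 ∂(gaussianReal θ.1 (σ ^ 2).toNNReal)

/-- The worst-case mean square regret over the parameter set `T`. It is an extended real, since
the regret of a rule can be unbounded. -/
def worstCase (σ : ℝ) (T : Set (ℝ × ℝ)) (δ : ℝ → ℝ) : EReal :=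
  ⨆ θ ∈ T, ((risk σ δ θ : ℝ) : EReal)

/-- `δ` is mean square regret minimax optimal over `T`: it is a rule, and its worst case is the
minimum of the worst cases of all rules. -/
def IsMinimaxOptimal (σ : ℝ) (T : Set (ℝ × ℝ)) (δ : ℝ → ℝ) : Prop :=
  δ ∈ rules ∧ IsLeast (worstCase σ T '' rules) (worstCase σ T δ)

/-- The minimax value over `T`, i.e. the worst case of any minimax optimal rule over `T`. -/
def minimaxValue (σ : ℝ) (T : Set (ℝ × ℝ)) : EReal :=
  ⨅ δ ∈ rules, worstCase σ T δ

/-- The one-dimensional subproblem: the segment from `-(a_e, a_t)` to `(a_e, a_t)`. -/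
def segmentSpace (ae at' : ℝ) : Set (ℝ × ℝ) :=
  {θ | ∃ s ∈ Icc (-1 : ℝ) 1, θ = (s * ae, s * at')}

/-- Among all subproblems with `a_e ≥ 0` and `a_t ∈ I(a_e)`, the one given by `(a_e, a_t)` has the
largest minimax value. -/
def IsHardestSubproblem (σ k ae at' : ℝ) : Prop :=
  0 ≤ ae ∧ at' ∈ identifiedSet k ae ∧
    ∀ be : ℝ, 0 ≤ be → ∀ bt ∈ identifiedSet k be,
      minimaxValue σ (segmentSpace be bt) ≤ minimaxValue σ (segmentSpace ae at')

/-- `ρ(a) = E[(1 / (exp(2aY) + 1))²]`, where `Y ~ N(a, 1)`. -/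
def rho (a : ℝ) : ℝ :=
  ∫ y, (1 / (Real.exp (2 * a * y) + 1)) ^ 2 ∂(gaussianReal a 1)

/-- `a` is a maximizer of `f` over `s`. -/
def IsArgmax (f : ℝ → ℝ) (s : Set ℝ) (a : ℝ) : Prop := a ∈ s ∧ ∀ b ∈ s, f b ≤ f a

/-- `τ*` solves `sup_{τ ≥ 0} τ² ρ(τ)`. -/
def IsTauStar (τ : ℝ) : Prop := IsArgmax (fun t => t ^ 2 * rho t) (Ici 0) τ

/-- `a*` maximizes `(a + k/σ)² ρ(a)` over `[0, τ]`. -/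
def IsAStar (σ k τ a : ℝ) : Prop :=
  IsArgmax (fun b => (b + k / σ) ^ 2 * rho b) (Icc 0 τ) a

/-- The logistic rule `x ↦ exp(2ax/σ) / (exp(2ax/σ) + 1)`. -/
def logisticRule (σ a : ℝ) (x : ℝ) : ℝ :=
  Real.exp (2 * a * (x / σ)) / (Real.exp (2 * a * (x / σ)) + 1)

end MeanSquareRegret

end

open MeanSquareRegret

/-!
The logistic rule and the pair `±(a*σ, a*σ + k)` form a saddle point of the regret, and this is
proved after rescaling by `σ`, with `κ = k / σ`.

*Lower bound.* Put mass `1/2` on each of `±(aσ, aσ + k)`. The posterior mean of `1{θ_t ≥ 0}` is the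
logistic function of `2ax/σ`, so the logistic rule minimizes the Bayes risk, which is
`σ² (a + κ)² ρ(a)`. No rule has a smaller worst case on the segment (`two_mul_rho_le`,
`risk_le_worstCase_segmentSpace`).

*Upper bound.* Write `meanLoss a m` for `E[(1 / (exp(2aY) + 1))²]` with `Y ~ N(m, 1)`, so that
`ρ(a) = meanLoss a a`. Since this decreases in `m`, the least favourable `θ_e` for a given
`θ_t ≥ 0` is `θ_t - k` (negative `θ_t` are symmetric), and the worst case of the logistic rule is
the supremum of `(m + κ)² meanLoss a m` over `m ≥ -κ`. The factor `meanLoss a` is log-concave: minus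
its logarithmic derivative is the average of an increasing function under a family of densities
with monotone likelihood ratio, so it increases with `m` by Chebyshev's association inequality
(`meanDecay_mul_meanLoss_le`). Hence a stationary point of the product is a global maximum
(`add_sq_mul_meanLoss_le`), and it remains to see that `m = a` is stationary.

*Stationarity.* The two-point bound, applied to the logistic rules themselves, gives
`ρ(m) ≤ meanLoss a m`, with equality at `m = a`. So the two functions have the same derivative at `a`
(`hasDerivAt_rho`, an envelope theorem), and stationarity of `m ↦ (m + κ)² meanLoss a m` at `a` is
the first-order condition for `b ↦ (b + κ)² ρ(b)` at `a`. That condition holds because `a*` is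
interior to `[0, τ*]`: at `0` the derivative is `2κρ(0) > 0`, and at `τ*`, where
`2ρ(τ*) + τ* ρ'(τ*) = 0`, it is `(τ* + κ) κ ρ'(τ*) < 0` (`IsAStar.pos_and_two_mul_rho_eq`).

The hardest-subproblem claim follows from the saddle point, since every segment lies in `Θ`.
-/

noncomputable section

namespace MeanSquareRegret

/-! ### The loss of the logistic rule and Gaussian averages -/

/-- The squared loss `(1 - δ(y))²`, at a positive target effect, of the logistic rule `δ` with
parameter `a` and unit noise. -/
def loss (a y : ℝ) : ℝ := (1 / (Real.exp (2 * a * y) + 1)) ^ 2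

/-- The decay rate `-(log (loss a))'` of the loss. -/
def hazard (a y : ℝ) : ℝ :=
  4 * a * (Real.exp (2 * a * y) / (Real.exp (2 * a * y) + 1))

/-- The expected loss of the logistic rule with parameter `a` when the estimate is `N(m, 1)`. -/
def meanLoss (a m : ℝ) : ℝ := ∫ y, loss a y ∂(gaussianReal m 1)

/-- The expectation of `-(loss a)'` under `N(m, 1)`, which is minus the derivative of
`meanLoss a` at `m`. -/
def meanDecay (a m : ℝ) : ℝ := ∫ y, hazard a y * loss a y ∂(gaussianReal m 1)

lemma rho_eq_meanLoss (a : ℝ) : rho a = meanLoss a a := rfl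

lemma integral_gaussianReal_eq_integral_add (F : ℝ → ℝ) (m : ℝ) :
    ∫ y, F y ∂(gaussianReal m 1) = ∫ z, F (m + z) ∂(gaussianReal 0 1) := by
  have h := gaussianReal_map_const_add (μ := 0) (v := 1) m
  rw [zero_add] at h
  rw [← h]
  exact (Homeomorph.addLeft m).measurableEmbedding.integral_map F

lemma integral_gaussianReal_neg (F : ℝ → ℝ) (m : ℝ) :
    ∫ y, F y ∂(gaussianReal (-m) 1) = ∫ y, F (-y) ∂(gaussianReal m 1) := by
  rw [← gaussianReal_map_neg]
  exact (Homeomorph.neg ℝ).measurableEmbedding.integral_map F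

lemma integral_gaussianReal_scale {σ : ℝ} (hσ : 0 < σ) (F : ℝ → ℝ) (m : ℝ) :
    ∫ x, F x ∂(gaussianReal (σ * m) (σ ^ 2).toNNReal) =
      ∫ y, F (σ * y) ∂(gaussianReal m 1) := by
  have h := gaussianReal_map_const_mul (μ := m) (v := 1) σ
  have e : (σ ^ 2).toNNReal = NNReal.mk (σ ^ 2) (sq_nonneg σ) * 1 := by
    rw [mul_one]; exact Real.toNNReal_of_nonneg _
  rw [e, ← h]
  exact (Homeomorph.mulLeft₀ σ hσ.ne').measurableEmbedding.integral_map F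

/-- Exponential tilting: the density of `N(m, 1)` relative to `N(0, 1)` is
`exp (m y - m² / 2)`. -/
lemma integral_gaussianReal_eq_integral_exp (F : ℝ → ℝ) (m : ℝ) :
    ∫ y, F y ∂(gaussianReal m 1) =
      Real.exp (-(m ^ 2 / 2)) * ∫ y, F y * Real.exp (m * y) ∂(gaussianReal 0 1) := by
  rw [integral_gaussianReal_eq_integral_smul one_ne_zero,
    integral_gaussianReal_eq_integral_smul one_ne_zero, ← integral_const_mul]
  congr 1 with y
  have : Real.exp (-(y - m) ^ 2 / (2 * (1 : NNReal))) =
      Real.exp (-(m ^ 2 / 2)) * Real.exp (m * y) * Real.exp (-(y - 0) ^ 2 / (2 * (1 : NNReal))) := by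
    rw [← Real.exp_add, ← Real.exp_add]
    congr 1
    simp; ring
  simp only [gaussianPDFReal_def, smul_eq_mul, this]
  ring

lemma integrable_mul_exp {F : ℝ → ℝ} (hF : Measurable F) {C : ℝ} (hC : ∀ y, |F y| ≤ C) (m : ℝ) :
    Integrable (fun y => F y * Real.exp (m * y)) (gaussianReal 0 1) :=
  (integrable_exp_mul_gaussianReal m).bdd_mul hF.aestronglyMeasurable (Filter.Eventually.of_forall hC)

lemma integrable_of_abs_le {F : ℝ → ℝ} (hF : Measurable F) {C : ℝ} (hC : ∀ y, |F y| ≤ C) (m : ℝ) :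
    Integrable F (gaussianReal m 1) :=
  Integrable.of_bound hF.aestronglyMeasurable C (Filter.Eventually.of_forall hC)

lemma loss_pos (a y : ℝ) : 0 < loss a y := by unfold loss; positivity

lemma loss_le_one (a y : ℝ) : loss a y ≤ 1 := by
  unfold loss
  have := Real.exp_pos (2 * a * y)
  refine pow_le_one₀ (by positivity) ?_
  rw [div_le_one (by positivity)]
  linarith

lemma abs_loss_le (a y : ℝ) : |loss a y| ≤ 1 := by
  rw [abs_of_pos (loss_pos a y)]; exact loss_le_one a y

lemma measurable_loss (a : ℝ) : Measurable (loss a) := by unfold loss; fun_prop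

lemma measurable_hazard (a : ℝ) : Measurable (hazard a) := by unfold hazard; fun_prop

lemma exp_div_mem (x : ℝ) : Real.exp x / (Real.exp x + 1) ∈ Icc (0 : ℝ) 1 := by
  have := Real.exp_pos x
  refine ⟨by positivity, ?_⟩
  rw [div_le_one (by positivity)]
  linarith

lemma abs_hazard_mul_loss_le (a y : ℝ) : |hazard a y * loss a y| ≤ 4 * |a| := by
  obtain ⟨h0, h1⟩ := exp_div_mem (2 * a * y)
  rw [abs_mul, hazard, abs_mul, abs_mul, abs_of_nonneg h0, abs_of_nonneg (by norm_num : (0:ℝ) ≤ 4)]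
  calc _ ≤ 4 * |a| * 1 * 1 := by gcongr; exact abs_loss_le a y
    _ = _ := by ring

lemma monotone_hazard {a : ℝ} (ha : 0 ≤ a) : Monotone (hazard a) := by
  intro x y hxy
  unfold hazard
  have : Real.exp (2 * a * x) ≤ Real.exp (2 * a * y) := by
    apply Real.exp_le_exp.2; gcongr
  gcongr 4 * a * ?_
  have := Real.exp_pos (2 * a * x)
  rw [div_le_div_iff₀ (by positivity) (by positivity)]
  linarith

lemma antitone_loss {a : ℝ} (ha : 0 ≤ a) : Antitone (loss a) := by
  intro x y hxy
  unfold loss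
  gcongr

lemma integrable_loss (a m : ℝ) : Integrable (loss a) (gaussianReal m 1) :=
  integrable_of_abs_le (measurable_loss a) (abs_loss_le a) m

lemma meanLoss_pos (a m : ℝ) : 0 < meanLoss a m := by
  rw [meanLoss, integral_pos_iff_support_of_nonneg (fun y => (loss_pos a y).le)
    (integrable_loss a m)]
  have : Function.support (loss a) = univ :=
    eq_univ_of_forall fun y => (loss_pos a y).ne'
  simp [this]

lemma meanDecay_pos {a : ℝ} (ha : 0 < a) (m : ℝ) : 0 < meanDecay a m := by
  have h : ∀ y, 0 < hazard a y * loss a y := fun y =>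
    mul_pos (by unfold hazard; positivity) (loss_pos a y)
  rw [meanDecay, integral_pos_iff_support_of_nonneg (fun y => (h y).le)
    (integrable_of_abs_le ((measurable_hazard a).mul (measurable_loss a))
      (abs_hazard_mul_loss_le a) m)]
  have : Function.support (fun y => hazard a y * loss a y) = univ :=
    eq_univ_of_forall fun y => (h y).ne'
  simp [this]

lemma antitone_meanLoss {a : ℝ} (ha : 0 ≤ a) : Antitone (meanLoss a) := by
  intro m n hmn
  have e : ∀ m, meanLoss a m = ∫ z, loss a (m + z) ∂(gaussianReal 0 1) := fun m =>
    integral_gaussianReal_eq_integral_add _ _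
  rw [e, e]
  have hi : ∀ m, Integrable (fun z => loss a (m + z)) (gaussianReal 0 1) := fun m =>
    integrable_of_abs_le ((measurable_loss a).comp (measurable_const_add m))
      (fun z => abs_loss_le a _) 0
  exact integral_mono (hi n) (hi m) fun z => antitone_loss ha (by linarith)

/-! ### Log-concavity of the expected loss -/

lemma hasDerivAt_sq_one_div_exp_add_one {u : ℝ → ℝ} {u' x : ℝ} (hu : HasDerivAt u u' x) :
    HasDerivAt (fun x => (1 / (Real.exp (u x) + 1)) ^ 2)
      (-(2 * (Real.exp (u x) / (Real.exp (u x) + 1)) * (1 / (Real.exp (u x) + 1)) ^ 2 * u')) x := by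
  have hE := Real.exp_pos (u x)
  have h : HasDerivAt (fun x => ((Real.exp (u x) + 1)⁻¹) ^ 2)
      (2 * (Real.exp (u x) + 1)⁻¹ ^ 1 * (-(Real.exp (u x) * u') / (Real.exp (u x) + 1) ^ 2)) x :=
    ((hu.exp.add_const 1).inv (by positivity)).pow 2
  simp only [one_div]
  refine h.congr_deriv ?_
  field_simp

lemma hasDerivAt_loss (a y : ℝ) : HasDerivAt (loss a) (-(hazard a y * loss a y)) y := by
  have h : HasDerivAt (fun y => 2 * a * y) (2 * a * 1) y := (hasDerivAt_id y).const_mul (2 * a)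
  refine (hasDerivAt_sq_one_div_exp_add_one h).congr_deriv ?_
  simp only [hazard, loss]
  ring

lemma hasDerivAt_meanLoss (a m : ℝ) : HasDerivAt (meanLoss a) (-meanDecay a m) m := by
  have hm : ∀ n, Measurable fun z => loss a (n + z) := fun n =>
    (measurable_loss a).comp (measurable_const_add n)
  have h := (hasDerivAt_integral_of_dominated_loc_of_deriv_le (μ := gaussianReal 0 1)
    (F := fun n z => loss a (n + z)) (F' := fun n z => -(hazard a (n + z) * loss a (n + z)))
    (x₀ := m) (s := univ) (bound := fun _ => 4 * |a|) Filter.univ_mem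
    (Filter.Eventually.of_forall fun n => (hm n).aestronglyMeasurable)
    (integrable_of_abs_le (hm m) (fun z => abs_loss_le a _) 0)
    (((measurable_hazard a).comp (measurable_const_add m)).mul
      (hm m)).neg.aestronglyMeasurable
    (Filter.Eventually.of_forall fun z n _ => by
      rw [norm_neg]; exact abs_hazard_mul_loss_le a _)
    (integrable_const _)
    (Filter.Eventually.of_forall fun z n _ => (hasDerivAt_loss a (n + z)).comp_add_const n z)).2
  have e : meanLoss a = fun n => ∫ z, loss a (n + z) ∂(gaussianReal 0 1) := by
    ext n; exact integral_gaussianReal_eq_integral_add _ _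
  rw [e, meanDecay, integral_gaussianReal_eq_integral_add, ← integral_neg]
  exact h

/-- Chebyshev's double-integral argument: the hypothesis is the integrand of
`∫∫ (A(x)D(y) - C(x)B(y))`, symmetrized in `x` and `y`. -/
lemma integral_mul_integral_le_of_symm {γ : Measure ℝ} [SFinite γ] {A B C D : ℝ → ℝ}
    (hA : Integrable A γ) (hB : Integrable B γ) (hC : Integrable C γ) (hD : Integrable D γ)
    (h : ∀ x y, 0 ≤ (A x * D y - C x * B y) + (D x * A y - B x * C y)) :
    (∫ x, C x ∂γ) * ∫ x, B x ∂γ ≤ (∫ x, D x ∂γ) * ∫ x, A x ∂γ := by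
  have i1 := hA.mul_prod hD
  have i2 := hC.mul_prod hB
  have i3 := hD.mul_prod hA
  have i4 := hB.mul_prod hC
  have i12 : Integrable (fun p : ℝ × ℝ => A p.1 * D p.2 - C p.1 * B p.2) (γ.prod γ) := i1.sub i2
  have i34 : Integrable (fun p : ℝ × ℝ => D p.1 * A p.2 - B p.1 * C p.2) (γ.prod γ) := i3.sub i4
  have key : 0 ≤ ∫ p : ℝ × ℝ, ((A p.1 * D p.2 - C p.1 * B p.2) +
      (D p.1 * A p.2 - B p.1 * C p.2)) ∂(γ.prod γ) := integral_nonneg fun p => h p.1 p.2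
  rw [integral_add i12 i34, integral_sub i1 i2, integral_sub i3 i4,
    integral_prod_mul, integral_prod_mul, integral_prod_mul, integral_prod_mul] at key
  linarith

/-- The ratio `meanDecay a m / meanLoss a m` increases with `m`, i.e. `meanLoss a` is
log-concave. After tilting, the claim is a Chebyshev inequality for the increasing functions
`hazard a` and `y ↦ exp ((n - m) y)`. -/
lemma meanDecay_mul_meanLoss_le {a : ℝ} (ha : 0 ≤ a) {m n : ℝ} (hmn : m ≤ n) :
    meanDecay a m * meanLoss a n ≤ meanDecay a n * meanLoss a m := by
  have hL : ∀ m, Integrable (fun y => loss a y * Real.exp (m * y)) (gaussianReal 0 1) := fun m =>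
    integrable_mul_exp (measurable_loss a) (abs_loss_le a) m
  have hD : ∀ m, Integrable (fun y => hazard a y * loss a y * Real.exp (m * y))
      (gaussianReal 0 1) := fun m =>
    integrable_mul_exp ((measurable_hazard a).mul (measurable_loss a))
      (abs_hazard_mul_loss_le a) m
  have key := integral_mul_integral_le_of_symm (hL m) (hL n) (hD m) (hD n) fun x y => by
    have e : 0 ≤ (hazard a y - hazard a x) *
        (Real.exp (m * x) * Real.exp (n * y) - Real.exp (n * x) * Real.exp (m * y)) := by
      rw [← Real.exp_add, ← Real.exp_add]
      rcases le_total x y with h | h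
      · refine mul_nonneg (sub_nonneg.2 (monotone_hazard ha h)) (sub_nonneg.2 ?_)
        apply Real.exp_le_exp.2; nlinarith
      · refine mul_nonneg_of_nonpos_of_nonpos (sub_nonpos.2 (monotone_hazard ha h))
          (sub_nonpos.2 ?_)
        apply Real.exp_le_exp.2; nlinarith
    have := mul_nonneg (mul_pos (loss_pos a x) (loss_pos a y)).le e
    linarith
  have eL : ∀ m, meanLoss a m = _ := integral_gaussianReal_eq_integral_exp (loss a)
  have eD : ∀ m, meanDecay a m = _ :=
    integral_gaussianReal_eq_integral_exp fun y => hazard a y * loss a y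
  rw [eL, eL, eD, eD]
  have hc : 0 ≤ Real.exp (-(m ^ 2 / 2)) * Real.exp (-(n ^ 2 / 2)) := by positivity
  linarith [mul_le_mul_of_nonneg_left key hc]

/-! ### The Bayes risk of a symmetric two-point prior -/

/-- Against weights `p` and `q`, the mean squared error `p (1 - d)² + q d²` is least at the posterior
probability `d = p / (p + q)`. -/
lemma logistic_bayes {p q : ℝ} (hp : 0 < p) (hq : 0 < q) (d : ℝ) :
    p * (1 - p / (p + q)) ^ 2 + q * (p / (p + q)) ^ 2 ≤ p * (1 - d) ^ 2 + q * d ^ 2 := by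
  have h : p * (1 - d) ^ 2 + q * d ^ 2 - (p * (1 - p / (p + q)) ^ 2 + q * (p / (p + q)) ^ 2)
      = (p + q) * (d - p / (p + q)) ^ 2 := by field_simp; ring
  have : 0 ≤ (p + q) * (d - p / (p + q)) ^ 2 := by positivity
  linarith

lemma abs_sq_le_one {d : ℝ} (hd : d ∈ Icc (0 : ℝ) 1) : |d ^ 2| ≤ 1 := by
  rw [abs_of_nonneg (sq_nonneg d)]; exact pow_le_one₀ hd.1 hd.2

lemma one_sub_mem {d : ℝ} (hd : d ∈ Icc (0 : ℝ) 1) : 1 - d ∈ Icc (0 : ℝ) 1 :=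
  ⟨by linarith [hd.2], by linarith [hd.1]⟩

lemma one_sub_logistic (x : ℝ) :
    1 - Real.exp x / (Real.exp x + 1) = 1 / (Real.exp x + 1) := by
  have := Real.exp_pos x
  field_simp; ring

lemma logistic_neg (x : ℝ) :
    Real.exp (-x) / (Real.exp (-x) + 1) = 1 / (Real.exp x + 1) := by
  have := Real.exp_pos x
  rw [Real.exp_neg]
  field_simp
  ring

/-- Twice the Bayes risk of `δ` under the uniform prior on the means `m` and `-m`, as an integral
against `N(0, 1)`. -/
lemma twoPoint_eq_exp {δ : ℝ → ℝ} (hδ : δ ∈ rules) (m : ℝ) :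
    (∫ y, (1 - δ y) ^ 2 ∂(gaussianReal m 1)) + ∫ y, δ y ^ 2 ∂(gaussianReal (-m) 1) =
      Real.exp (-(m ^ 2 / 2)) * ∫ y, (Real.exp (m * y) * (1 - δ y) ^ 2 +
        Real.exp (-m * y) * δ y ^ 2) ∂(gaussianReal 0 1) ∧
    Integrable (fun y => Real.exp (m * y) * (1 - δ y) ^ 2 + Real.exp (-m * y) * δ y ^ 2)
      (gaussianReal 0 1) := by
  have hm := hδ.1
  have i1 : Integrable (fun y => Real.exp (m * y) * (1 - δ y) ^ 2) (gaussianReal 0 1) := by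
    simpa only [mul_comm] using integrable_mul_exp (F := fun y => (1 - δ y) ^ 2) (by fun_prop)
      (fun y => abs_sq_le_one (one_sub_mem (hδ.2 y))) m
  have i2 : Integrable (fun y => Real.exp (-m * y) * δ y ^ 2) (gaussianReal 0 1) := by
    simpa only [mul_comm] using integrable_mul_exp (F := fun y => δ y ^ 2) (by fun_prop)
      (fun y => abs_sq_le_one (hδ.2 y)) (-m)
  refine ⟨?_, i1.add i2⟩
  rw [integral_gaussianReal_eq_integral_exp _ m, integral_gaussianReal_eq_integral_exp _ (-m),
    integral_add i1 i2, neg_sq, mul_add]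
  simp only [mul_comm (Real.exp (_ * _))]

lemma logisticRule_mem_rules (σ a : ℝ) : logisticRule σ a ∈ rules :=
  ⟨by unfold logisticRule; fun_prop, fun _ => exp_div_mem _⟩

lemma one_sub_logisticRule_sq (σ a x : ℝ) : (1 - logisticRule σ a x) ^ 2 = loss a (x / σ) := by
  rw [logisticRule, one_sub_logistic, loss]

lemma logisticRule_neg_sq (σ a x : ℝ) : logisticRule σ a (-x) ^ 2 = loss a (x / σ) := by
  rw [logisticRule, neg_div, mul_neg, logistic_neg, loss]

/-- `ρ(m)` is the least Bayes risk under the uniform prior on the means `m` and `-m`, since the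
posterior probability of `m` is the logistic rule with parameter `m`. -/
lemma two_mul_rho_le {δ : ℝ → ℝ} (hδ : δ ∈ rules) (m : ℝ) :
    2 * rho m ≤
      (∫ y, (1 - δ y) ^ 2 ∂(gaussianReal m 1)) + ∫ y, δ y ^ 2 ∂(gaussianReal (-m) 1) := by
  obtain ⟨e, i⟩ := twoPoint_eq_exp hδ m
  obtain ⟨e', i'⟩ := twoPoint_eq_exp (logisticRule_mem_rules 1 m) m
  have h : 2 * rho m = (∫ y, (1 - logisticRule 1 m y) ^ 2 ∂(gaussianReal m 1)) +
      ∫ y, logisticRule 1 m y ^ 2 ∂(gaussianReal (-m) 1) := by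
    rw [integral_gaussianReal_neg]
    simp only [one_sub_logisticRule_sq, logisticRule_neg_sq, div_one]
    rw [rho_eq_meanLoss, meanLoss]; ring
  rw [h, e, e']
  refine mul_le_mul_of_nonneg_left (integral_mono i' i fun y => ?_) (Real.exp_pos _).le
  have hl : logisticRule 1 m y =
      Real.exp (m * y) / (Real.exp (m * y) + Real.exp (-m * y)) := by
    have h2 : Real.exp (2 * m * (y / 1)) = Real.exp (m * y) * Real.exp (m * y) := by
      rw [← Real.exp_add]; ring_nf
    have h3 : Real.exp (-m * y) = (Real.exp (m * y))⁻¹ := by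
      rw [← Real.exp_neg]; ring_nf
    have := Real.exp_pos (m * y)
    rw [logisticRule, h2, h3]
    field_simp
  simp only [hl]
  exact logistic_bayes (Real.exp_pos _) (Real.exp_pos _) _

lemma rho_le_meanLoss (a m : ℝ) : rho m ≤ meanLoss a m := by
  have h := two_mul_rho_le (logisticRule_mem_rules 1 a) m
  rw [integral_gaussianReal_neg] at h
  simp only [one_sub_logisticRule_sq, logisticRule_neg_sq, div_one] at h
  rw [meanLoss]
  linarith

/-! ### Derivative of `ρ` -/

lemma differentiableAt_rho (a : ℝ) : DifferentiableAt ℝ rho a := by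
  have hd : ∀ z b : ℝ, HasDerivAt (fun b => loss b (b + z))
      (-(2 * (Real.exp (2 * b * (b + z)) / (Real.exp (2 * b * (b + z)) + 1)) *
        loss b (b + z) * (4 * b + 2 * z))) b := by
    intro z b
    have h : HasDerivAt (fun b => 2 * b * (b + z)) (4 * b + 2 * z) b :=
      (((hasDerivAt_id b).const_mul 2).mul ((hasDerivAt_id b).add_const z)).congr_deriv
        (by simp only [id]; ring)
    exact hasDerivAt_sq_one_div_exp_add_one h
  have hb : Integrable (fun z : ℝ => 2 * (4 * (|a| + 1) + 2 * |z|)) (gaussianReal 0 1) := by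
    have : Integrable (fun z : ℝ => z) (gaussianReal 0 1) :=
      (memLp_id_gaussianReal 1).integrable le_rfl
    exact ((integrable_const _).add (this.abs.const_mul 2)).const_mul 2
  have hm : ∀ b, Measurable fun z => loss b (b + z) := fun b =>
    (measurable_loss b).comp (measurable_const_add b)
  have h := (hasDerivAt_integral_of_dominated_loc_of_deriv_le (μ := gaussianReal 0 1)
    (F := fun b z => loss b (b + z))
    (F' := fun b z => -(2 * (Real.exp (2 * b * (b + z)) / (Real.exp (2 * b * (b + z)) + 1)) *
        loss b (b + z) * (4 * b + 2 * z)))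
    (x₀ := a) (s := Metric.ball a 1) (Metric.ball_mem_nhds a one_pos)
    (Filter.Eventually.of_forall fun n => (hm n).aestronglyMeasurable)
    (integrable_of_abs_le (hm a) (fun z => abs_loss_le a _) 0)
    (by have := hm a; exact Measurable.aestronglyMeasurable (by fun_prop))
    (Filter.Eventually.of_forall fun z b hbz => by
      obtain ⟨h0, h1⟩ := exp_div_mem (2 * b * (b + z))
      have hab : |b| ≤ |a| + 1 := by
        rw [Metric.mem_ball, Real.dist_eq] at hbz
        have := abs_sub_abs_le_abs_sub b a
        linarith
      rw [norm_neg, Real.norm_eq_abs, abs_mul, abs_mul, abs_mul, abs_of_nonneg h0, abs_two]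
      calc _ ≤ 2 * 1 * 1 * (4 * (|a| + 1) + 2 * |z|) := by
            gcongr
            · exact abs_loss_le _ _
            · refine (abs_add_le _ _).trans ?_
              rw [abs_mul, abs_mul, abs_two, abs_of_pos (by norm_num : (0:ℝ) < 4)]
              gcongr
        _ = _ := by ring) hb
    (Filter.Eventually.of_forall fun z b _ => hd z b)).2
  have e : rho = fun b => ∫ z, loss b (b + z) ∂(gaussianReal 0 1) := by
    ext b; exact integral_gaussianReal_eq_integral_add _ _
  rw [e]
  exact h.differentiableAt

/-- Envelope theorem: `ρ` and `meanLoss a` are tangent at `a`, because `ρ ≤ meanLoss a` with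
equality at `a`. -/
lemma hasDerivAt_rho (a : ℝ) : HasDerivAt rho (-meanDecay a a) a := by
  have h := (differentiableAt_rho a).hasDerivAt
  have hs := (hasDerivAt_meanLoss a a).sub h
  have hmin : IsLocalMin (meanLoss a - rho) a := Filter.Eventually.of_forall fun m => by
    have := rho_le_meanLoss a m
    simp only [Pi.sub_apply, rho_eq_meanLoss a, sub_self]
    linarith
  have h0 := hmin.hasDerivAt_eq_zero hs
  have : -meanDecay a a = deriv rho a := by linarith
  rwa [this]

lemma continuous_rho : Continuous rho :=
  continuous_iff_continuousAt.2 fun a => (hasDerivAt_rho a).continuousAt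

/-! ### Existence and first-order conditions of `τ*` and `a*` -/

lemma rho_le_exp (t : ℝ) : rho t ≤ Real.exp (-(t ^ 2 / 2)) := by
  rw [rho_eq_meanLoss, meanLoss, integral_gaussianReal_eq_integral_exp]
  refine mul_le_of_le_one_right (Real.exp_pos _).le ?_
  have : ∫ y, loss t y * Real.exp (t * y) ∂(gaussianReal 0 1) ≤ ∫ y : ℝ, (1 : ℝ) ∂(gaussianReal 0 1) := by
    refine integral_mono (integrable_mul_exp (measurable_loss t) (abs_loss_le t) t)
      (integrable_const _) fun y => ?_
    have hp := Real.exp_pos (t * y)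
    -- The pointwise bound is `w ≤ (w² + 1)²` for `w = exp (t y)`.
    have h2 : Real.exp (2 * t * y) = Real.exp (t * y) ^ 2 := by
      rw [← Real.exp_nat_mul]; push_cast; ring_nf
    simp only [loss, h2]
    rw [div_pow, one_pow, div_mul_eq_mul_div, one_mul, div_le_one (by positivity)]
    nlinarith [sq_nonneg (Real.exp (t * y) - 1), sq_nonneg (Real.exp (t * y) ^ 2)]
  simpa using this

lemma exists_isTauStar : ∃ τ, IsTauStar τ := by
  have hc : Continuous fun t : ℝ => t ^ 2 * rho t := (continuous_pow 2).mul continuous_rho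
  -- The function tends to `0` and is positive at `1`, so a maximum over a compact interval
  -- containing `1` is global.
  have hpos : 0 < (1 : ℝ) ^ 2 * rho 1 := by
    rw [rho_eq_meanLoss]; have := meanLoss_pos 1 1; positivity
  have hlim : Filter.Tendsto (fun t : ℝ => t ^ 2 * rho t) Filter.atTop (nhds 0) := by
    have h1 : Filter.Tendsto (fun t : ℝ => 2 * ((t ^ 2 / 2) ^ 1 * Real.exp (-(t ^ 2 / 2))))
        Filter.atTop (nhds (2 * 0)) :=
      (((Real.tendsto_pow_mul_exp_neg_atTop_nhds_zero 1).comp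
        ((Filter.tendsto_pow_atTop two_ne_zero).atTop_div_const two_pos))).const_mul 2
    rw [mul_zero] at h1
    refine squeeze_zero (fun t => ?_) (fun t => ?_) h1
    · have := meanLoss_pos t t
      rw [rho_eq_meanLoss]; positivity
    · have := mul_le_mul_of_nonneg_left (rho_le_exp t) (sq_nonneg t)
      linarith
  obtain ⟨T, hT⟩ := Filter.eventually_atTop.1 (hlim.eventually (gt_mem_nhds hpos))
  obtain ⟨τ, hτ, hmax⟩ := isCompact_Icc.exists_isMaxOn
    (nonempty_Icc.2 (zero_le_one.trans (le_max_right T 1))) hc.continuousOn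
  refine ⟨τ, hτ.1, fun t ht => ?_⟩
  rcases le_total t (max T 1) with h | h
  · exact hmax ⟨ht, h⟩
  · exact ((hT t ((le_max_left _ _).trans h)).le).trans (hmax ⟨zero_le_one, le_max_right _ _⟩)

lemma IsTauStar.pos {τ : ℝ} (h : IsTauStar τ) : 0 < τ := by
  refine lt_of_le_of_ne h.1 fun h0 => ?_
  have h1 := h.2 1 (mem_Ici.2 zero_le_one)
  have := meanLoss_pos 1 1
  simp only [← h0, rho_eq_meanLoss] at h1
  norm_num at h1
  linarith

lemma exists_isAStar (σ k : ℝ) {τ : ℝ} (hτ : 0 ≤ τ) : ∃ a, IsAStar σ k τ a := by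
  have hc : Continuous fun t : ℝ => (t + k / σ) ^ 2 * rho t :=
    ((continuous_id.add continuous_const).pow 2).mul continuous_rho
  obtain ⟨a, ha, hmax⟩ := isCompact_Icc.exists_isMaxOn (nonempty_Icc.2 hτ) hc.continuousOn
  exact ⟨a, ha, fun b hb => hmax hb⟩

lemma hasDerivAt_add_sq_mul {f : ℝ → ℝ} {d x : ℝ} (κ : ℝ) (hf : HasDerivAt f (-d) x) :
    HasDerivAt (fun x => (x + κ) ^ 2 * f x) ((x + κ) * (2 * f x - (x + κ) * d)) x := by
  have h : HasDerivAt (fun x => (x + κ) ^ 2) (2 * (x + κ)) x := by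
    exact (((hasDerivAt_id x).add_const κ).pow 2).congr_deriv (by simp)
  exact (h.mul hf).congr_deriv (by ring)

lemma IsTauStar.two_mul_rho_eq {τ : ℝ} (h : IsTauStar τ) : 2 * rho τ = τ * meanDecay τ τ := by
  have hd := hasDerivAt_add_sq_mul 0 (hasDerivAt_rho τ)
  simp only [add_zero] at hd
  have hmax : IsLocalMax (fun t : ℝ => t ^ 2 * rho t) τ := by
    filter_upwards [Ici_mem_nhds h.pos] with t ht using h.2 t ht
  have := hmax.hasDerivAt_eq_zero hd
  have := (mul_eq_zero.1 this).resolve_left h.pos.ne'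
  linarith

/-- `a*` is positive, and the derivative of `b ↦ (b + k/σ)² ρ(b)` vanishes there: `a*` lies in the
interior of `[0, τ*]`, because the derivative is positive at `0` and negative at `τ*`. -/
lemma IsAStar.pos_and_two_mul_rho_eq {σ k τ a : ℝ} (hκ : 0 < k / σ) (hτ : IsTauStar τ)
    (h : IsAStar σ k τ a) : 0 < a ∧ 2 * rho a = (a + k / σ) * meanDecay a a := by
  set κ := k / σ
  have hτ0 := hτ.pos
  have hd := hasDerivAt_add_sq_mul κ (hasDerivAt_rho a)
  have hL := meanLoss_pos a a
  -- The derivative at a maximizer over `[0, τ]` is nonpositive in every feasible direction.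
  have htan : ∀ b ∈ Icc 0 τ,
      (b - a) * ((a + κ) * (2 * rho a - (a + κ) * meanDecay a a)) ≤ 0 := fun b hb => by
    have hmax : IsMaxOn (fun b => (b + κ) ^ 2 * rho b) (Icc 0 τ) a := fun b hb => h.2 b hb
    simpa using hmax.localize.hasFDerivWithinAt_nonpos hd.hasFDerivAt.hasFDerivWithinAt
      (sub_mem_posTangentConeAt_of_segment_subset ((convex_Icc 0 τ).segment_subset h.1 hb))
  have hl := htan 0 (left_mem_Icc.2 hτ0.le)
  have hr := htan τ (right_mem_Icc.2 hτ0.le)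
  have h0 : 0 < a := by
    refine lt_of_le_of_ne h.1.1 fun h0 => ?_
    have hz : meanDecay a a = 0 := by simp [meanDecay, hazard, ← h0]
    rw [hz, rho_eq_meanLoss, ← h0] at hr
    rw [← h0] at hL
    have : 0 < τ * (κ * (2 * meanLoss 0 0)) := by positivity
    linarith
  have hlt : a < τ := by
    refine lt_of_le_of_ne h.1.2 fun h1 => ?_
    have hD := meanDecay_pos h0 a
    have e := hτ.two_mul_rho_eq
    rw [← h1] at e
    rw [e] at hl
    have : 0 < a * ((a + κ) * (κ * meanDecay a a)) := by positivity
    linarith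
  refine ⟨h0, ?_⟩
  have h1 : (a + κ) * (2 * rho a - (a + κ) * meanDecay a a) = 0 :=
    le_antisymm (nonpos_of_mul_nonpos_right hr (sub_pos.2 hlt))
      (nonneg_of_mul_nonneg_right (by linarith : 0 ≤ a * _) h0)
  have := (mul_eq_zero.1 h1).resolve_left (by positivity)
  linarith

/-! ### The worst case of the logistic rule -/

/-- By log-concavity, a stationary point `a` of `m ↦ (m + κ)² meanLoss a m` is a maximum over
`m ≥ -κ`: the sign of the derivative is that of `2 - (m + κ) meanDecay a m / meanLoss a m`, which
decreases in `m`. -/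
lemma add_sq_mul_meanLoss_le {a κ : ℝ} (ha : 0 ≤ a)
    (haκ : 0 < a + κ) (hfoc : 2 * meanLoss a a = (a + κ) * meanDecay a a) {m : ℝ}
    (hm : 0 ≤ m + κ) : (m + κ) ^ 2 * meanLoss a m ≤ (a + κ) ^ 2 * meanLoss a a := by
  have hd : ∀ x, HasDerivAt (fun x => (x + κ) ^ 2 * meanLoss a x)
      ((x + κ) * (2 * meanLoss a x - (x + κ) * meanDecay a x)) x := fun x =>
    hasDerivAt_add_sq_mul κ (hasDerivAt_meanLoss a x)
  have hc : Continuous fun x => (x + κ) ^ 2 * meanLoss a x :=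
    continuous_iff_continuousAt.2 fun x => (hd x).continuousAt
  have hL := meanLoss_pos a a
  rcases le_total m a with h | h
  · refine monotoneOn_of_deriv_nonneg (convex_Icc m a) hc.continuousOn
      (fun x _ => (hd x).differentiableAt.differentiableWithinAt) (fun x hx => ?_)
      (left_mem_Icc.2 h) (right_mem_Icc.2 h) h
    rw [interior_Icc] at hx
    rw [(hd x).deriv]
    have hx0 : 0 ≤ x + κ := by linarith [hx.1]
    refine mul_nonneg hx0 (sub_nonneg.2 ?_)
    have h1 := meanDecay_mul_meanLoss_le ha hx.2.le
    have hx1 : x + κ ≤ a + κ := by linarith [hx.2]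
    have hLx := meanLoss_pos a x
    refine le_of_mul_le_mul_right (a := meanLoss a a) ?_ hL
    calc (x + κ) * meanDecay a x * meanLoss a a
        ≤ (x + κ) * (meanDecay a a * meanLoss a x) := by
          rw [mul_assoc]; gcongr
      _ ≤ (a + κ) * (meanDecay a a * meanLoss a x) := by
          gcongr
          have : 0 ≤ (a + κ) * meanDecay a a := by linarith
          exact mul_nonneg (nonneg_of_mul_nonneg_right this haκ) hLx.le
      _ = _ := by rw [← mul_assoc, ← hfoc]; ring
  · refine antitoneOn_of_deriv_nonpos (convex_Icc a m) hc.continuousOn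
      (fun x _ => (hd x).differentiableAt.differentiableWithinAt) (fun x hx => ?_)
      (left_mem_Icc.2 h) (right_mem_Icc.2 h) h
    rw [interior_Icc] at hx
    rw [(hd x).deriv]
    have hx0 : 0 ≤ x + κ := by linarith [hx.1]
    refine mul_nonpos_of_nonneg_of_nonpos hx0 (sub_nonpos.2 ?_)
    have h1 := meanDecay_mul_meanLoss_le ha hx.1.le
    have hx1 : a + κ ≤ x + κ := by linarith [hx.1]
    have hLx := meanLoss_pos a x
    refine le_of_mul_le_mul_right (a := meanLoss a a) ?_ hL
    calc 2 * meanLoss a x * meanLoss a a = (a + κ) * (meanDecay a a * meanLoss a x) := by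
          rw [← mul_assoc, ← hfoc]; ring
      _ ≤ (x + κ) * (meanDecay a a * meanLoss a x) := by
          gcongr
          have : 0 ≤ (a + κ) * meanDecay a a := by linarith
          exact mul_nonneg (nonneg_of_mul_nonneg_right this haκ) hLx.le
      _ ≤ (x + κ) * meanDecay a x * meanLoss a a := by
          rw [mul_assoc]; gcongr

/-- Rescaling by `σ` reduces the regret to unit noise. -/
lemma risk_scale {σ : ℝ} (hσ : 0 < σ) (δ : ℝ → ℝ) (e t : ℝ) :
    risk σ δ (σ * e, σ * t) =
      σ ^ 2 * (t ^ 2 * ∫ y, (oracle t - δ (σ * y)) ^ 2 ∂(gaussianReal e 1)) := by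
  have ho : oracle (σ * t) = oracle t := by
    unfold oracle; simp only [mul_nonneg_iff_of_pos_left hσ]
  simp only [risk, ho]
  rw [integral_gaussianReal_scale hσ (fun x => (oracle t - δ x) ^ 2)]
  ring

lemma risk_logisticRule_of_nonneg {σ : ℝ} (hσ : 0 < σ) (a e : ℝ) {t : ℝ} (ht : 0 ≤ t) :
    risk σ (logisticRule σ a) (σ * e, σ * t) = σ ^ 2 * (t ^ 2 * meanLoss a e) := by
  rw [risk_scale hσ]
  simp only [oracle, if_pos ht, one_sub_logisticRule_sq, mul_div_cancel_left₀ _ hσ.ne']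
  rfl

lemma risk_logisticRule_of_neg {σ : ℝ} (hσ : 0 < σ) (a e : ℝ) {t : ℝ} (ht : t < 0) :
    risk σ (logisticRule σ a) (σ * e, σ * t) = σ ^ 2 * (t ^ 2 * meanLoss a (-e)) := by
  rw [risk_scale hσ, ← neg_neg e, integral_gaussianReal_neg]
  simp only [oracle, if_neg ht.not_ge, zero_sub, neg_sq, mul_neg, logisticRule_neg_sq,
    mul_div_cancel_left₀ _ hσ.ne', neg_neg]
  rfl

lemma mem_paramSpace {k : ℝ} {θ : ℝ × ℝ} :
    θ ∈ paramSpace k ↔ θ.1 - k ≤ θ.2 ∧ θ.2 ≤ θ.1 + k := Iff.rfl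

lemma segmentSpace_subset {k be bt : ℝ} (hb : bt ∈ identifiedSet k be) :
    segmentSpace be bt ⊆ paramSpace k := by
  rintro _ ⟨s, ⟨hs1, hs2⟩, rfl⟩
  obtain ⟨h1, h2⟩ := hb
  rw [mem_paramSpace]
  have hk : 0 ≤ k := by linarith
  have : |s * (bt - be)| ≤ 1 * k := by
    rw [abs_mul]
    gcongr
    · exact abs_le.2 ⟨hs1, hs2⟩
    · exact abs_le.2 ⟨by linarith, by linarith⟩
  rw [abs_le] at this
  constructor <;> simp only <;> linarith [this.1, this.2]

lemma worstCase_mono {σ : ℝ} {S T : Set (ℝ × ℝ)} (h : S ⊆ T) (δ : ℝ → ℝ) :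
    worstCase σ S δ ≤ worstCase σ T δ :=
  biSup_mono fun _ hθ => h hθ

/-! ### The saddle point -/

/-- The logistic rule has its largest regret over `Θ` at `(aσ, aσ + k)`. -/
lemma risk_logisticRule_le {σ k a : ℝ} (hσ : 0 < σ) (ha : 0 ≤ a) (haκ : 0 < a + k / σ)
    (hfoc : 2 * meanLoss a a = (a + k / σ) * meanDecay a a) {θ : ℝ × ℝ} (hθ : θ ∈ paramSpace k) :
    risk σ (logisticRule σ a) θ ≤ risk σ (logisticRule σ a) (a * σ, a * σ + k) := by
  obtain ⟨e, t, rfl⟩ : ∃ e t, θ = (σ * e, σ * t) :=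
    ⟨θ.1 / σ, θ.2 / σ, by ext <;> simp [mul_div_cancel₀ _ hσ.ne']⟩
  have hstar : (a * σ, a * σ + k) = (σ * a, σ * (a + k / σ)) := by
    ext <;> simp only <;> field_simp
  have hk : k = σ * (k / σ) := by field_simp
  obtain ⟨h1, h2⟩ := mem_paramSpace.1 hθ
  simp only at h1 h2
  rw [hk, ← mul_sub, mul_le_mul_iff_right₀ hσ] at h1
  rw [hk, ← mul_add, mul_le_mul_iff_right₀ hσ] at h2
  rw [hstar, risk_logisticRule_of_nonneg hσ a a haκ.le]
  rcases le_or_gt 0 t with ht | ht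
  · rw [risk_logisticRule_of_nonneg hσ a e ht]
    gcongr σ ^ 2 * ?_
    have h := add_sq_mul_meanLoss_le ha haκ hfoc (m := t - k / σ) (by linarith)
    rw [sub_add_cancel] at h
    exact (mul_le_mul_of_nonneg_left (antitone_meanLoss ha (by linarith)) (sq_nonneg t)).trans h
  · rw [risk_logisticRule_of_neg hσ a e ht]
    gcongr σ ^ 2 * ?_
    have h := add_sq_mul_meanLoss_le ha haκ hfoc (m := -t - k / σ) (by linarith)
    rw [sub_add_cancel, neg_sq] at h
    exact (mul_le_mul_of_nonneg_left (antitone_meanLoss ha (by linarith)) (sq_nonneg t)).trans h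

/-- Every rule has at one of `±(aσ, aσ + k)` at least the regret of the logistic rule at
`(aσ, aσ + k)`. -/
lemma risk_le_worstCase_segmentSpace {σ k a : ℝ} (hσ : 0 < σ) (haκ : 0 < a + k / σ)
    {δ : ℝ → ℝ} (hδ : δ ∈ rules) :
    (risk σ (logisticRule σ a) (a * σ, a * σ + k) : EReal) ≤
      worstCase σ (segmentSpace (a * σ) (a * σ + k)) δ := by
  have hstar : (a * σ, a * σ + k) = (σ * a, σ * (a + k / σ)) := by
    ext <;> simp only <;> field_simp
  have hneg : (-(a * σ), -(a * σ + k)) = (σ * -a, σ * -(a + k / σ)) := by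
    ext <;> simp only <;> field_simp
  have hδ' : (fun y => δ (σ * y)) ∈ rules :=
    ⟨hδ.1.comp (measurable_const_mul σ), fun y => hδ.2 _⟩
  have hsum : 2 * risk σ (logisticRule σ a) (a * σ, a * σ + k) ≤
      risk σ δ (a * σ, a * σ + k) + risk σ δ (-(a * σ), -(a * σ + k)) := by
    have hn : ¬ 0 ≤ -(a + k / σ) := by linarith
    rw [hneg, hstar, risk_logisticRule_of_nonneg hσ a a haκ.le, risk_scale hσ, risk_scale hσ,
      ← rho_eq_meanLoss]
    simp only [oracle, if_pos haκ.le, if_neg hn, zero_sub, neg_sq]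
    have := mul_le_mul_of_nonneg_left (two_mul_rho_le hδ' a)
      (by positivity : 0 ≤ σ ^ 2 * (a + k / σ) ^ 2)
    linarith
  have hor : risk σ (logisticRule σ a) (a * σ, a * σ + k) ≤ risk σ δ (a * σ, a * σ + k) ∨
      risk σ (logisticRule σ a) (a * σ, a * σ + k) ≤ risk σ δ (-(a * σ), -(a * σ + k)) := by
    by_contra! h
    linarith [h.1, h.2]
  rcases hor with h | h
  · refine (EReal.coe_le_coe_iff.2 h).trans (le_iSup₂_of_le _ ⟨1, by norm_num, ?_⟩ le_rfl)
    simp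
  · refine (EReal.coe_le_coe_iff.2 h).trans (le_iSup₂_of_le _ ⟨-1, by norm_num, ?_⟩ le_rfl)
    simp

end MeanSquareRegret

end

theorem theorem1 (σ k : ℝ) (hσ : 0 < σ) (hk : 0 < k) :
    (∃ τ : ℝ, IsTauStar τ) ∧
    ∀ τ : ℝ, IsTauStar τ →
      (∃ a : ℝ, IsAStar σ k τ a) ∧
      ∀ a : ℝ, IsAStar σ k τ a →
        IsMinimaxOptimal σ (paramSpace k) (logisticRule σ a) ∧
        IsHardestSubproblem σ k (a * σ) (a * σ + k) ∧
        worstCase σ (paramSpace k) (logisticRule σ a) =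
          worstCase σ (segmentSpace (a * σ) (a * σ + k)) (logisticRule σ a) ∧
        (∃ θ ∈ segmentSpace (a * σ) (a * σ + k), ∀ θ' ∈ paramSpace k,
          risk σ (logisticRule σ a) θ' ≤ risk σ (logisticRule σ a) θ) := by
  refine ⟨exists_isTauStar, fun τ hτ => ⟨exists_isAStar σ k hτ.1, fun a ha => ?_⟩⟩
  have hκ : 0 < k / σ := div_pos hk hσ
  obtain ⟨ha0, hfoc⟩ := ha.pos_and_two_mul_rho_eq hκ hτ
  have haκ : 0 < a + k / σ := by positivity
  have hrule := logisticRule_mem_rules σ a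
  have hup : ∀ θ ∈ paramSpace k, risk σ (logisticRule σ a) θ ≤
      risk σ (logisticRule σ a) (a * σ, a * σ + k) := fun θ hθ =>
    risk_logisticRule_le hσ ha0.le haκ hfoc hθ
  have hmem : a * σ + k ∈ identifiedSet k (a * σ) := ⟨by linarith, le_rfl⟩
  have hsub := segmentSpace_subset hmem
  have hle : worstCase σ (paramSpace k) (logisticRule σ a) ≤
      (risk σ (logisticRule σ a) (a * σ, a * σ + k) : EReal) :=
    iSup₂_le fun θ hθ => EReal.coe_le_coe_iff.2 (hup θ hθ)
  have hlow : ∀ δ ∈ rules, (risk σ (logisticRule σ a) (a * σ, a * σ + k) : EReal) ≤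
      worstCase σ (segmentSpace (a * σ) (a * σ + k)) δ := fun δ hδ =>
    risk_le_worstCase_segmentSpace hσ haκ hδ
  refine ⟨⟨hrule, ⟨_, hrule, rfl⟩, ?_⟩, ⟨by positivity, hmem, fun be _ bt hbt => ?_⟩, ?_,
    ⟨_, ⟨1, by norm_num, by rw [one_mul, one_mul]⟩, hup⟩⟩
  · rintro _ ⟨δ, hδ, rfl⟩
    exact hle.trans ((hlow δ hδ).trans (worstCase_mono hsub δ))
  · exact (iInf₂_le _ hrule).trans
      (((worstCase_mono (segmentSpace_subset hbt) _).trans hle).trans (le_iInf₂ hlow))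
  · exact le_antisymm (hle.trans (hlow _ hrule)) (worstCase_mono hsub _)
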